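/- All Hilbert spaces are complex, and inner products are linear in the first argument. Let $H_+$, $H_0$, $H_-$ be Hilbert spaces, let $\langle\cdot,\cdot\rangle_{H_-,H_+}\colon H_-\times H_+\to\mathbb{C}$ be continuous and sesquilinear (linear in the first, antilinear in the second argument), and suppose that $(H_+,H_-)$ is a complete dual pair, i.e. the maps $g\mapsto\langle g,\cdot\rangle_{H_-,H_+}$ and $f\mapsto\overline{\langle\cdot,f\rangle_{H_-,H_+}}$ are isometric bijections of $H_-$ and $H_+$ onto the antidual spaces of $H_+$ and $H_-$, respectively. Let $\iota_+\colon\operatorname{dom}\iota_+\subseteq H_+\to H_0$ and $\iota_-\colon\operatorname{dom}\iota_-\subseteq H_-\to H_0$ be densely defined, closed, injective linear operators with dense range such that $$\langle g,f\rangle_{H_-,H_+}=\langle\iota_-g,\iota_+f\rangle_{H_0}\qquad\text{for all } f\in\operatorname{dom}\iota_+,\ g\in\operatorname{dom}\iota_-,$$ and such that $\operatorname{dom}\iota_+^{*}=\operatorname{ran}\iota_-$, where $\iota_+^{*}$ is the adjoint with respect to the dual pairs $(H_+,H_-)$ and $(H_0,H_0)$, that is, the set of all $(h,g)\in H_0\times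 H_-$ with $\langle h,\iota_+f\rangle_{H_0}=\langle g,f\rangle_{H_-,H_+}$ for all $f\in\operatorname{dom}\iota_+$. (In other words, $(H_+,H_0,H_-)$ is a quasi Gelfand triple of Hilbert spaces.) Define the Gram operators on $H_0$ by $G_\pm=(\iota_\pm^{-1})^{\mathrm h}\,\iota_\pm^{-1}$ on their natural domains, where $^{\mathrm h}$ denotes the usual Hilbert space adjoint. Then $G_+$ is injective and $$G_-=G_+^{-1}.$$ Moreover, $G_+$ and $G_-$ have unique positive self-adjoint square roots $G_+^{1/2}$ and $G_-^{1/2}$ (i.e. self-adjoint operators $S$ with $\langle Sx,x\rangle\ge 0$ on $\operatorname{dom}S$ and $SS=G_\pm$, including equality of domains), and $$\operatorname{ran}\iota_-=\operatorname{dom}G_-^{1/2}=\operatorname{dom}G_+^{-1/2}=\operatorname{ran}G_+^{1/2},$$ where $G_+^{-1/2}=(G_+^{1/2})^{-1}$. -/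

import Mathlib

noncomputable section

open scoped ComplexConjugate

namespace QuasiGelfand

/-- A bounded sesquilinear pairing `Y × X → ℂ`, linear in the first and antilinear in the second
argument. `p y x` is `⟨y, x⟩_{Y,X}`. As a map into the antidual of `X` it is `Ψ : y ↦ ⟨y, ·⟩`. -/
abbrev Pairing (Y X : Type*) [NormedAddCommGroup Y] [NormedSpace ℂ Y]
    [NormedAddCommGroup X] [NormedSpace ℂ X] : Type _ :=
  Y →L[ℂ] X →L⋆[ℂ] ℂ

section DualPair

variable {X Y : Type*} [NormedAddCommGroup X] [NormedSpace ℂ X]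
  [NormedAddCommGroup Y] [NormedSpace ℂ Y]

/-- The map `Φ : X → Y'` into the antidual of `Y`, `Φ x = (y ↦ conj ⟨y, x⟩)`. -/
def Pairing.swap (p : Pairing Y X) (x : X) : Y →L⋆[ℂ] ℂ :=
  ((starL ℂ : ℂ ≃L⋆[ℂ] ℂ) : ℂ →L⋆[ℂ] ℂ).comp (p.flip x)

theorem Pairing.swap_apply (p : Pairing Y X) (x : X) (y : Y) :
    p.swap x y = conj (p y x) := rfl

/-- `(X, Y)` is a complete (anti-)dual pair with pairing `p`: both canonical maps
`Ψ : Y → X'` and `Φ : X → Y'` into the antiduals are isometric and bijective. -/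
structure IsCompleteDualPair (p : Pairing Y X) : Prop where
  isometry_left : Isometry (fun y : Y => p y)
  bijective_left : Function.Bijective (fun y : Y => p y)
  isometry_right : Isometry p.swap
  bijective_right : Function.Bijective p.swap

end DualPair

/-- The dual pairing of the complete dual pair `(H, H)`: the inner product of the Hilbert space
`H`, taken linear in the first argument (Mathlib's `inner` is linear in the second one). -/
def hilbertPairing (H : Type*) [NormedAddCommGroup H] [InnerProductSpace ℂ H] : Pairing H H :=
  (innerSL ℂ).flip

theorem hilbertPairing_apply {H : Type*} [NormedAddCommGroup H] [InnerProductSpace ℂ H]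
    (x y : H) : hilbertPairing H x y = inner ℂ y x := rfl

/-- The adjoint linear relation of a linear relation `A ⊆ X₁ × X₂` with respect to the pairings
`p₁` on `Y₁ × X₁` and `p₂` on `Y₂ × X₂`: all `(y₂, y₁)` with `⟨y₂, x₂⟩ = ⟨y₁, x₁⟩` for all
`(x₁, x₂) ∈ A`. -/
def adjointRel {X₁ Y₁ X₂ Y₂ : Type*}
    [NormedAddCommGroup X₁] [NormedSpace ℂ X₁] [NormedAddCommGroup Y₁] [NormedSpace ℂ Y₁]
    [NormedAddCommGroup X₂] [NormedSpace ℂ X₂] [NormedAddCommGroup Y₂] [NormedSpace ℂ Y₂]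
    (p₁ : Pairing Y₁ X₁) (p₂ : Pairing Y₂ X₂) (A : Submodule ℂ (X₁ × X₂)) :
    Submodule ℂ (Y₂ × Y₁) where
  carrier := {y | ∀ x ∈ A, p₂ y.1 x.2 = p₁ y.2 x.1}
  zero_mem' := by intro x _; simp
  add_mem' := by
    intro a b ha hb x hx
    simp [ha x hx, hb x hx]
  smul_mem' := by
    intro c a ha x hx
    simp [ha x hx]

/-- The range of a partially defined operator. -/
def ran {E F : Type*} [AddCommGroup E] [Module ℂ E] [AddCommGroup F] [Module ℂ F]
    (T : E →ₗ.[ℂ] F) : Submodule ℂ F :=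
  LinearMap.range T.toFun

section Triple

variable {Hp H0 Hm : Type*}
  [NormedAddCommGroup Hp] [NormedSpace ℂ Hp]
  [NormedAddCommGroup H0] [InnerProductSpace ℂ H0]
  [NormedAddCommGroup Hm] [NormedSpace ℂ Hm]

/-- A densely defined, closed, injective linear operator with dense range. -/
structure IsClosedEmbedding {E F : Type*} [NormedAddCommGroup E] [NormedSpace ℂ E]
    [NormedAddCommGroup F] [NormedSpace ℂ F] (ι : E →ₗ.[ℂ] F) : Prop where
  dense_domain : Dense (ι.domain : Set E)
  isClosed : ι.IsClosed
  injective : Function.Injective ι.toFun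
  dense_range : Dense (ran ι : Set F)

/-- `(Hp, H0, Hm)` with the dual pairing `p` of `(Hp, Hm)` and the embeddings `ιp`, `ιm` is a
quasi Gelfand triple. In `pairing_eq` both sides are linear in `g` and antilinear in `f`. -/
structure IsQuasiGelfandTriple (p : Pairing Hm Hp) (ιp : Hp →ₗ.[ℂ] H0) (ιm : Hm →ₗ.[ℂ] H0) :
    Prop where
  dualPair : IsCompleteDualPair p
  embedding_plus : IsClosedEmbedding ιp
  embedding_minus : IsClosedEmbedding ιm
  pairing_eq : ∀ (f : ιp.domain) (g : ιm.domain), p (g : Hm) (f : Hp) = inner ℂ (ιp f) (ιm g)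
  dom_adjoint_eq :
    (adjointRel p (hilbertPairing H0) ιp.graph).map (LinearMap.fst ℂ H0 Hm) = ran ιm

end Triple

/-- The composition `S T` of partially defined operators, on its natural domain
`{x ∈ dom T | T x ∈ dom S}`. -/
def pcomp {E F G : Type*} [AddCommGroup E] [Module ℂ E] [AddCommGroup F] [Module ℂ F]
    [AddCommGroup G] [Module ℂ G] (S : F →ₗ.[ℂ] G) (T : E →ₗ.[ℂ] F) : E →ₗ.[ℂ] G :=
  S.comp (T.domRestrict ((S.domain.comap T.toFun).map T.domain.subtype)) (by
    rintro ⟨x, hx, hx'⟩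
    obtain ⟨y, hy, rfl⟩ := hx
    exact hy)

theorem mem_pcomp_graph {E F G : Type*} [AddCommGroup E] [Module ℂ E] [AddCommGroup F]
    [Module ℂ F] [AddCommGroup G] [Module ℂ G] (S : F →ₗ.[ℂ] G) (T : E →ₗ.[ℂ] F) (x : E) (z : G) :
    (x, z) ∈ (pcomp S T).graph ↔ ∃ y : F, (x, y) ∈ T.graph ∧ (y, z) ∈ S.graph := by
  simp only [LinearPMap.mem_graph_iff]
  constructor
  · rintro ⟨⟨w, hw, hw'⟩, rfl, rfl⟩
    obtain ⟨y, hy, rfl⟩ := hw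
    exact ⟨T y, ⟨y, rfl, rfl⟩, ⟨T y, hy⟩, rfl, rfl⟩
  · rintro ⟨_, ⟨v, rfl, rfl⟩, ⟨u, hu, rfl⟩⟩
    have hv : T v ∈ S.domain := hu ▸ u.2
    refine ⟨⟨(v : E), ⟨v, hv, rfl⟩, v.2⟩, rfl, ?_⟩
    have : u = ⟨T v, hv⟩ := Subtype.ext hu
    rw [this]
    rfl

/-- The Gram operator `(ι⁻¹)* ι⁻¹` on `H0` of an embedding `ι` of `H` into `H0`, where the adjoint
is the Hilbert space adjoint. -/
def gram {H H0 : Type*} [NormedAddCommGroup H] [InnerProductSpace ℂ H]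
    [NormedAddCommGroup H0] [InnerProductSpace ℂ H0] [CompleteSpace H0]
    (ι : H →ₗ.[ℂ] H0) : H0 →ₗ.[ℂ] H0 :=
  pcomp ι.inverse.adjoint ι.inverse

/-- `S` is a positive square root `G^{1/2}` of the operator `G`: `S` is self-adjoint and positive
(in the sense `0 ≤ ⟨S x, x⟩`), and `S S = G`, including domains. -/
structure IsPositiveSqrt {H : Type*} [NormedAddCommGroup H] [InnerProductSpace ℂ H]
    [CompleteSpace H] (G S : H →ₗ.[ℂ] H) : Prop where
  isSelfAdjoint : IsSelfAdjoint S
  nonneg : ∀ x : S.domain, 0 ≤ (inner ℂ (S x) (x : H)).re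
  sq_eq : pcomp S S = G

end QuasiGelfand

end

/-!
The closed densely defined operator `T = ι⁻¹` determines the bounded operators `R = (1 + T* T)⁻¹`
and `Q = T R`, obtained together by projecting `(x, 0)` orthogonally onto the graph of `T`
(`exists_isResolventPair`). The positive square roots are reduced to bounded operators through
this pair, so that no unbounded functional calculus is needed.

* Existence: with the commuting bounded square roots `C = R^{1/2}` and `D = (1 - R)^{1/2}`, the
  operator with graph `{(C x, D x)}` is self-adjoint and positive, and its square is
  `{(R x, x - R x)} = T* T` (`exists_isPositiveSqrt`).
* Uniqueness: a positive square root `S` of `G` has `R = (1 + G)⁻¹`, its `Q = S R` is the positive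
  square root of `R - R²`, and its graph is the closure of `{(R x, Q x)}`
  (`IsPositiveSqrt.unique`).
* Domain: `‖T (R x)‖` depends only on `R`, since `‖R x‖² + ‖T (R x)‖² = ⟪R x, x⟫`. As the range of
  `R` is a core, `T` and `(T* T)^{1/2}` have the same domain (`IsPositiveSqrt.domain_eq`).

For the triple, the complete dual pair and the Riesz isomorphism give a unitary `U` from `Hm` to
`Hp`, and the assumption on the domain of the adjoint says that `ιm⁻¹ = U⁻¹ ιp*`. Hence
`gram ιm = ιp ιp* = (gram ιp)⁻¹` (`IsQuasiGelfandTriple.gram_minus_eq`). By uniqueness the square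
root of `gram ιm` is the inverse of that of `gram ιp`, and its domain is that of `ιm⁻¹`, the range
of `ιm`.
-/

namespace QuasiGelfand

/-! ### Graphs of partially defined operators -/

section Graphs

variable {H K : Type*} [NormedAddCommGroup H] [InnerProductSpace ℂ H]
  [NormedAddCommGroup K] [InnerProductSpace ℂ K]

theorem mem_graph_adjoint_iff [CompleteSpace H] {T : H →ₗ.[ℂ] K}
    (hT : Dense (T.domain : Set H)) {y : K} {z : H} :
    (y, z) ∈ T.adjoint.graph ↔ ∀ f g, (f, g) ∈ T.graph → inner ℂ g y = inner ℂ f z := by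
  simp [LinearPMap.adjoint_graph_eq_graph_adjoint hT, sub_eq_zero]

theorem mem_graph_inverse_iff {E F : Type*} [AddCommGroup E] [Module ℂ E] [AddCommGroup F]
    [Module ℂ F] {T : E →ₗ.[ℂ] F} (hT : Function.Injective T.toFun) {x : E} {y : F} :
    (y, x) ∈ T.inverse.graph ↔ (x, y) ∈ T.graph := by
  rw [LinearPMap.inverse_graph (LinearMap.ker_eq_bot.mpr hT)]
  constructor
  · rintro ⟨⟨a, b⟩, hab, h⟩
    obtain ⟨rfl, rfl⟩ := Prod.mk.inj h
    exact hab
  · exact fun h => ⟨(x, y), h, rfl⟩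

theorem injective_toFun_iff {E F : Type*} [AddCommGroup E] [Module ℂ E] [AddCommGroup F]
    [Module ℂ F] {T : E →ₗ.[ℂ] F} :
    Function.Injective T.toFun ↔ ∀ x, (x, (0 : F)) ∈ T.graph → x = 0 := by
  rw [injective_iff_map_eq_zero]
  constructor
  · intro h x hx
    obtain ⟨a, rfl, ha⟩ := (LinearPMap.mem_graph_iff T).mp hx
    simp [h a ha]
  · intro h a ha
    refine Subtype.ext (h a ?_)
    rw [← ha]
    exact T.mem_graph a

theorem graph_ext {E F : Type*} [AddCommGroup E] [Module ℂ E] [AddCommGroup F]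
    [Module ℂ F] {S T : E →ₗ.[ℂ] F} (h : ∀ x y, (x, y) ∈ S.graph ↔ (x, y) ∈ T.graph) : S = T :=
  LinearPMap.eq_of_eq_graph (by ext ⟨x, y⟩; exact h x y)

end Graphs

/-! ### The resolvent of `T* T` -/

section Resolvent

variable {H K L : Type*} [NormedAddCommGroup H] [InnerProductSpace ℂ H] [CompleteSpace H]
  [NormedAddCommGroup K] [InnerProductSpace ℂ K]
  [NormedAddCommGroup L] [InnerProductSpace ℂ L]

/-- `R` and `Q` are the bounded operators `R = (1 + T* T)⁻¹` and `Q = T R`, characterised by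
`Q x = T (R x)` and `T* (Q x) = x - R x`. -/
structure IsResolventPair (T : H →ₗ.[ℂ] K) (R : H →L[ℂ] H) (Q : H →L[ℂ] K) : Prop where
  dense_domain : Dense (T.domain : Set H)
  mem_graph : ∀ x, (R x, Q x) ∈ T.graph
  mem_graph_adjoint : ∀ x, (Q x, x - R x) ∈ T.adjoint.graph

/-- `(R x, Q x)` is the orthogonal projection of `(x, 0)` onto the graph of `T`. -/
theorem exists_isResolventPair [CompleteSpace K] {T : H →ₗ.[ℂ] K} (hd : Dense (T.domain : Set H))
    (hc : T.IsClosed) : ∃ R Q, IsResolventPair T R Q := by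
  let e := WithLp.prodContinuousLinearEquiv 2 ℂ H K
  let Γ : Submodule ℂ (WithLp 2 (H × K)) := T.graph.comap (e : WithLp 2 (H × K) →ₗ[ℂ] H × K)
  have hΓ : IsClosed (Γ : Set (WithLp 2 (H × K))) := hc.preimage e.continuous
  have : CompleteSpace Γ := hΓ.completeSpace_coe
  let P : H →L[ℂ] H × K := (e : WithLp 2 (H × K) →L[ℂ] H × K) ∘L Γ.starProjection ∘L
    (e.symm : H × K →L[ℂ] WithLp 2 (H × K)) ∘L ContinuousLinearMap.inl ℂ H K
  refine ⟨ContinuousLinearMap.fst ℂ H K ∘L P, ContinuousLinearMap.snd ℂ H K ∘L P, hd,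
    fun x => ?_, fun x => ?_⟩
  · exact Γ.starProjection_apply_mem _
  · rw [mem_graph_adjoint_iff hd]
    intro f g hfg
    have h := Γ.sub_starProjection_mem_orthogonal (e.symm (x, 0)) (e.symm (f, g)) hfg
    rw [WithLp.prod_inner_apply] at h
    have h' : inner ℂ f (x - (P x).1) + inner ℂ g (0 - (P x).2) = 0 := h
    rw [zero_sub, inner_neg_right, ← sub_eq_add_neg, sub_eq_zero] at h'
    exact h'.symm

namespace IsResolventPair

variable {T : H →ₗ.[ℂ] K} {R : H →L[ℂ] H} {Q : H →L[ℂ] K}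

theorem inner_apply (h : IsResolventPair T R Q) {f : H} {g : K} (hfg : (f, g) ∈ T.graph) (x : H) :
    inner ℂ g (Q x) = inner ℂ f (x - R x) :=
  (mem_graph_adjoint_iff h.dense_domain).mp (h.mem_graph_adjoint x) f g hfg

/-- `R (f + T* T f) = f` and `T R (f + T* T f) = T f`: injectivity of `1 + T* T`. -/
theorem eq_of_chain (h : IsResolventPair T R Q) {f k : H} {g : K} (hfg : (f, g) ∈ T.graph)
    (hgk : (g, k) ∈ T.adjoint.graph) : R (f + k) = f ∧ Q (f + k) = g := by
  have h1 := T.graph.sub_mem hfg (h.mem_graph (f + k))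
  have h2 := T.adjoint.graph.sub_mem hgk (h.mem_graph_adjoint (f + k))
  have h3 := (mem_graph_adjoint_iff h.dense_domain).mp h2 _ _ h1
  have h4 : k - (f + k - R (f + k)) = -(f - R (f + k)) := by abel
  simp only [h4, inner_neg_right, inner_self_eq_norm_sq_to_K] at h3
  have h5 : ‖g - Q (f + k)‖ ^ 2 = -‖f - R (f + k)‖ ^ 2 := by exact_mod_cast h3
  have h6 : ‖g - Q (f + k)‖ = 0 := by nlinarith [sq_nonneg ‖f - R (f + k)‖]
  have h7 : ‖f - R (f + k)‖ = 0 := by nlinarith [sq_nonneg ‖g - Q (f + k)‖]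
  exact ⟨(sub_eq_zero.mp (norm_eq_zero.mp h7)).symm, (sub_eq_zero.mp (norm_eq_zero.mp h6)).symm⟩

/-- `T* T = R⁻¹ - 1`, domains included. -/
theorem mem_graph_pcomp_iff (h : IsResolventPair T R Q) {x z : H} :
    (x, z) ∈ (pcomp T.adjoint T).graph ↔ ∃ w, R w = x ∧ w - R w = z := by
  rw [mem_pcomp_graph]
  constructor
  · rintro ⟨y, hxy, hyz⟩
    have := (h.eq_of_chain hxy hyz).1
    exact ⟨x + z, this, by rw [this]; abel⟩
  · rintro ⟨w, rfl, rfl⟩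
    exact ⟨Q w, h.mem_graph w, h.mem_graph_adjoint w⟩

theorem inner_resolvent (h : IsResolventPair T R Q) (x y : H) :
    inner ℂ (R x) y = inner ℂ (R x) (R y) + inner ℂ (Q x) (Q y) := by
  rw [h.inner_apply (h.mem_graph x), inner_sub_right]
  ring

theorem re_inner_resolvent (h : IsResolventPair T R Q) (x : H) :
    (inner ℂ (R x) x).re = ‖R x‖ ^ 2 + ‖Q x‖ ^ 2 := by
  rw [h.inner_resolvent, inner_self_eq_norm_sq_to_K, inner_self_eq_norm_sq_to_K]
  norm_cast

theorem isSymmetric (h : IsResolventPair T R Q) : R.IsSymmetric := by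
  intro x y
  change inner ℂ (R x) y = inner ℂ x (R y)
  rw [← inner_conj_symm x, h.inner_resolvent x y, h.inner_resolvent y x]
  simp

theorem nonneg (h : IsResolventPair T R Q) : 0 ≤ R := by
  rw [ContinuousLinearMap.nonneg_iff_isPositive]
  refine ⟨h.isSymmetric, fun x => ?_⟩
  change 0 ≤ (inner ℂ (R x) x).re
  rw [h.re_inner_resolvent]
  positivity

theorem one_sub_nonneg (h : IsResolventPair T R Q) : 0 ≤ 1 - R := by
  rw [ContinuousLinearMap.nonneg_iff_isPositive]
  refine ⟨LinearMap.IsSymmetric.sub LinearMap.IsSymmetric.id h.isSymmetric, fun x => ?_⟩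
  change 0 ≤ (inner ℂ (x - R x) x).re
  have h1 := h.re_inner_resolvent x
  have h2 : (inner ℂ (R x) x).re ≤ ‖R x‖ * ‖x‖ := re_inner_le_norm (𝕜 := ℂ) (R x) x
  have h3 : (inner ℂ x x).re = ‖x‖ ^ 2 := (norm_sq_eq_re_inner (𝕜 := ℂ) x).symm
  rw [inner_sub_left, Complex.sub_re, h3]
  nlinarith [sq_nonneg (‖x‖ - ‖R x‖), sq_nonneg ‖Q x‖]

theorem injective (h : IsResolventPair T R Q) : Function.Injective R := by
  rw [injective_iff_map_eq_zero]
  intro x hx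
  have h1 := h.re_inner_resolvent x
  have h2 : Q x = 0 := by simpa [hx] using h1.symm
  have h3 := h.mem_graph_adjoint x
  rw [hx, h2, sub_zero] at h3
  exact T.adjoint.graph_fst_eq_zero_snd h3 rfl

theorem resolvent_unique {T' : H →ₗ.[ℂ] L} {R' : H →L[ℂ] H} {Q' : H →L[ℂ] L}
    (h : IsResolventPair T R Q) (h' : IsResolventPair T' R' Q')
    (hTT' : pcomp T.adjoint T = pcomp T'.adjoint T') : R = R' := by
  ext x
  have h1 : (R x, x - R x) ∈ (pcomp T.adjoint T).graph := h.mem_graph_pcomp_iff.mpr ⟨x, rfl, rfl⟩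
  rw [hTT', h'.mem_graph_pcomp_iff] at h1
  obtain ⟨w, hw, hw'⟩ := h1
  have : w = x := by
    rw [hw] at hw'
    exact sub_left_injective hw'
  rw [← hw, this]

/-- The domain of `T* T` is a core for `T`. -/
theorem graph_subset_closure [CompleteSpace K] (h : IsResolventPair T R Q) (hc : T.IsClosed) :
    (T.graph : Set (H × K)) ⊆ closure (Set.range fun x => (R x, Q x)) := by
  let e := WithLp.prodContinuousLinearEquiv 2 ℂ H K
  let Γ : Submodule ℂ (WithLp 2 (H × K)) := T.graph.comap (e : WithLp 2 (H × K) →ₗ[ℂ] H × K)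
  let J : H →L[ℂ] WithLp 2 (H × K) := (e.symm : H × K →L[ℂ] WithLp 2 (H × K)) ∘L R.prod Q
  let M : Submodule ℂ (WithLp 2 (H × K)) := J.range.topologicalClosure
  have hM : CompleteSpace M := J.range.isClosed_topologicalClosure.completeSpace_coe
  have hJΓ : J.range ≤ Γ := by
    rintro _ ⟨x, rfl⟩
    exact h.mem_graph x
  have hMΓ : M ≤ Γ := J.range.topologicalClosure_minimal hJΓ (hc.preimage e.continuous)
  -- a graph element orthogonal to all `(R x, Q x)` has first component orthogonal to every `x`
  have key : ∀ v ∈ Γ, v ∈ Mᗮ → v = 0 := by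
    intro v hv hvM
    have h0 : ∀ x, inner ℂ v.fst x = 0 := by
      intro x
      have h1 : inner ℂ v (J x) = 0 :=
        (Submodule.mem_orthogonal' _ _).mp hvM _ (J.range.le_topologicalClosure ⟨x, rfl⟩)
      rw [WithLp.prod_inner_apply] at h1
      have h2 : inner ℂ v.fst (R x) + inner ℂ v.snd (Q x) = 0 := h1
      rw [h.inner_apply (f := v.fst) (g := v.snd) hv, inner_sub_right] at h2
      linear_combination h2
    have h3 : v.fst = 0 := inner_self_eq_zero.mp (h0 v.fst)
    have h4 : v.snd = 0 := T.graph_fst_eq_zero_snd (x := v.fst) hv h3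
    exact e.injective (Prod.ext h3 h4)
  intro v hv
  have hv' : e.symm v ∈ M := by
    have h1 : e.symm v - M.starProjection (e.symm v) ∈ Γ :=
      Γ.sub_mem hv (hMΓ (M.starProjection_apply_mem _))
    have h2 := key _ h1 (M.sub_starProjection_mem_orthogonal _)
    rw [sub_eq_zero] at h2
    rw [h2]
    exact M.starProjection_apply_mem _
  have h5 := image_closure_subset_closure_image e.continuous ⟨_, hv', e.apply_symm_apply v⟩
  refine closure_mono ?_ h5
  rintro _ ⟨_, ⟨x, rfl⟩, rfl⟩
  exact ⟨x, rfl⟩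

/-- `T` is the closure of its restriction to the range of `R`, where `‖T (R x)‖` is determined by
`R` alone; so operators with the same `R` have the same domain. -/
theorem domain_le [CompleteSpace K] [CompleteSpace L] {T' : H →ₗ.[ℂ] L} {Q' : H →L[ℂ] L}
    (h : IsResolventPair T R Q) (h' : IsResolventPair T' R Q')
    (hc : T.IsClosed) (hc' : T'.IsClosed) : T.domain ≤ T'.domain := by
  intro f hf
  have hQ : ∀ x, ‖Q' x‖ = ‖Q x‖ := by
    intro x
    have := h.re_inner_resolvent x
    rw [h'.re_inner_resolvent] at this
    exact (sq_eq_sq₀ (norm_nonneg _) (norm_nonneg _)).mp (add_left_cancel this)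
  have hcl := h.graph_subset_closure hc (T.mem_graph ⟨f, hf⟩)
  obtain ⟨u, hu, hlim⟩ := mem_closure_iff_seq_limit.mp hcl
  choose x hx using hu
  obtain rfl : (fun n => (R (x n), Q (x n))) = u := funext hx
  have hR := (Prod.tendsto_iff _ _).mp hlim
  have hcau : CauchySeq fun n => Q' (x n) := by
    have h1 := hR.2.cauchySeq
    rw [Metric.cauchySeq_iff] at h1 ⊢
    simpa only [dist_eq_norm, ← map_sub, hQ] using h1
  obtain ⟨g, hg⟩ := cauchySeq_tendsto_of_complete hcau
  have hmem : (f, g) ∈ T'.graph :=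
    hc'.mem_of_tendsto (hR.1.prodMk_nhds hg) (Filter.Eventually.of_forall fun n => h'.mem_graph _)
  exact LinearPMap.mem_domain_of_mem_graph hmem

end IsResolventPair

end Resolvent

/-! ### Positive square roots -/

section Sqrt

variable {H K : Type*} [NormedAddCommGroup H] [InnerProductSpace ℂ H] [CompleteSpace H]
  [NormedAddCommGroup K] [InnerProductSpace ℂ K] [CompleteSpace K]

theorem _root_.IsSelfAdjoint.mem_graph_iff {S : H →ₗ.[ℂ] H} (hS : IsSelfAdjoint S) {y z : H} :
    (y, z) ∈ S.graph ↔ ∀ f g, (f, g) ∈ S.graph → inner ℂ g y = inner ℂ f z := by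
  rw [← mem_graph_adjoint_iff hS.dense_domain, LinearPMap.isSelfAdjoint_def.mp hS]

theorem isSelfAdjoint_of_mem_graph_iff {S : H →ₗ.[ℂ] H} (hd : Dense (S.domain : Set H))
    (h : ∀ y z, (y, z) ∈ S.graph ↔ ∀ f g, (f, g) ∈ S.graph → inner ℂ g y = inner ℂ f z) :
    IsSelfAdjoint S := by
  rw [LinearPMap.isSelfAdjoint_def]
  exact graph_ext fun y z => by rw [mem_graph_adjoint_iff hd, h]

namespace IsPositiveSqrt

variable {G S : H →ₗ.[ℂ] H}

theorem exists_isResolventPair (hS : IsPositiveSqrt G S) : ∃ R Q, IsResolventPair S R Q :=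
  QuasiGelfand.exists_isResolventPair hS.isSelfAdjoint.dense_domain hS.isSelfAdjoint.isClosed

theorem pcomp_adjoint_eq (hS : IsPositiveSqrt G S) : pcomp S.adjoint S = G := by
  rw [LinearPMap.isSelfAdjoint_def.mp hS.isSelfAdjoint, hS.sq_eq]

theorem re_inner_nonneg (hS : IsPositiveSqrt G S) {f g : H} (h : (f, g) ∈ S.graph) :
    0 ≤ (inner ℂ g f).re := by
  obtain ⟨a, rfl, rfl⟩ := (LinearPMap.mem_graph_iff S).mp h
  exact hS.nonneg a

/-- The bounded operator `Q = S (1 + S²)⁻¹` is positive with `Q² = R - R²`, so it is the square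
root of `R - R²`. -/
theorem sqrt_eq (hS : IsPositiveSqrt G S) {R Q : H →L[ℂ] H} (h : IsResolventPair S R Q) :
    CFC.sqrt (R - R * R) = Q := by
  have had := LinearPMap.isSelfAdjoint_def.mp hS.isSelfAdjoint
  have hQ2 : ∀ x, (Q x, x - R x) ∈ S.graph := fun x => by
    simpa only [had] using h.mem_graph_adjoint x
  have hsymm : ∀ {f g f' g' : H}, (f, g) ∈ S.graph → (f', g') ∈ S.graph →
      inner ℂ g f' = inner ℂ f g' := fun h1 h2 =>
    hS.isSelfAdjoint.mem_graph_iff.mp h2 _ _ h1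
  refine CFC.sqrt_unique ?_ ?_
  -- `S` commutes with `R`: the chain `Q (R x) ↦ R x - R (R x) ↦ Q x - Q (R x)` under `S` shows
  -- that `Q (Q x) = R x - R (R x)`
  · ext x
    have h1 := S.graph.sub_mem (h.mem_graph x) (h.mem_graph (R x))
    have h2 : (R x - R (R x), Q x - Q (R x)) ∈ S.adjoint.graph := by
      rwa [had]
    have h3 := (h.eq_of_chain (hQ2 (R x)) h2).2
    simpa using h3
  · rw [ContinuousLinearMap.nonneg_iff_isPositive]
    constructor
    · intro x y
      change inner ℂ (Q x) y = inner ℂ x (Q y)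
      have h1 := hsymm (h.mem_graph x) (h.mem_graph y)
      have h2 := hsymm (hQ2 x) (hQ2 y)
      rw [inner_sub_left, inner_sub_right] at h2
      linear_combination h1 - h2
    · intro x
      change 0 ≤ (inner ℂ (Q x) x).re
      have h1 := hS.re_inner_nonneg (h.mem_graph x)
      have h2 := hS.re_inner_nonneg (hQ2 x)
      rw [hsymm (hQ2 x) (hQ2 x), inner_sub_right, Complex.sub_re] at h2
      linarith

/-- `S` is the closure of the graph `{(R x, Q x)}`, where `R = (1 + G)⁻¹` and `Q` is the positive
square root of `R - R²`; both are determined by `G`. -/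
theorem unique {S' : H →ₗ.[ℂ] H} (hS : IsPositiveSqrt G S) (hS' : IsPositiveSqrt G S') :
    S = S' := by
  obtain ⟨R, Q, h⟩ := hS.exists_isResolventPair
  obtain ⟨R', Q', h'⟩ := hS'.exists_isResolventPair
  obtain rfl : R = R' :=
    h.resolvent_unique h' (hS.pcomp_adjoint_eq.trans hS'.pcomp_adjoint_eq.symm)
  have hQ : Q = Q' := by rw [← hS.sqrt_eq h, hS'.sqrt_eq h']
  subst hQ
  have key : ∀ {A B : H →ₗ.[ℂ] H}, IsResolventPair A R Q → IsResolventPair B R Q → A.IsClosed →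
      B.IsClosed → A ≤ B := by
    intro A B hA hB hAc hBc
    refine LinearPMap.le_of_le_graph ((hA.graph_subset_closure hAc).trans ?_)
    refine closure_minimal ?_ hBc
    rintro _ ⟨x, rfl⟩
    exact hB.mem_graph x
  exact le_antisymm (key h h' hS.isSelfAdjoint.isClosed hS'.isSelfAdjoint.isClosed)
    (key h' h hS'.isSelfAdjoint.isClosed hS.isSelfAdjoint.isClosed)

/-- `T` and the positive square root of `T* T` have the same resolvent `(1 + T* T)⁻¹`, hence the
same domain. -/
theorem domain_eq {T : H →ₗ.[ℂ] K} (hd : Dense (T.domain : Set H)) (hc : T.IsClosed)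
    (hS : IsPositiveSqrt (pcomp T.adjoint T) S) : T.domain = S.domain := by
  obtain ⟨R, Q, h⟩ := hS.exists_isResolventPair
  obtain ⟨R', Q', h'⟩ := QuasiGelfand.exists_isResolventPair hd hc
  obtain rfl : R = R' := h.resolvent_unique h' hS.pcomp_adjoint_eq
  exact le_antisymm (h'.domain_le h hc hS.isSelfAdjoint.isClosed)
    (h.domain_le h' hS.isSelfAdjoint.isClosed hc)

/-- If `S² = G` with `G` injective, then `S⁻¹` is the positive square root of `G⁻¹`. -/
theorem inverse (hS : IsPositiveSqrt G S) (hG : Function.Injective G.toFun) :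
    IsPositiveSqrt G.inverse S.inverse := by
  have hinj : Function.Injective S.toFun := by
    rw [injective_toFun_iff] at hG ⊢
    intro x hx
    refine hG x ?_
    rw [← hS.sq_eq, mem_pcomp_graph]
    exact ⟨0, hx, S.graph.zero_mem⟩
  have hd : Dense (S.inverse.domain : Set H) := by
    rw [Submodule.dense_iff_topologicalClosure_eq_top, Submodule.topologicalClosure_eq_top_iff,
      Submodule.eq_bot_iff]
    intro y hy
    refine injective_toFun_iff.mp hinj y (hS.isSelfAdjoint.mem_graph_iff.mpr ?_)
    intro f g hfg
    rw [inner_zero_right]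
    exact hy g (LinearPMap.mem_domain_of_mem_graph ((mem_graph_inverse_iff hinj).mpr hfg))
  refine ⟨isSelfAdjoint_of_mem_graph_iff hd fun y z => ?_, fun x => ?_, graph_ext fun x z => ?_⟩
  · rw [mem_graph_inverse_iff hinj, hS.isSelfAdjoint.mem_graph_iff]
    constructor
    · intro h f g hfg
      exact (h g f ((mem_graph_inverse_iff hinj).mp hfg)).symm
    · intro h f g hfg
      exact (h g f ((mem_graph_inverse_iff hinj).mpr hfg)).symm
  · have h := hS.re_inner_nonneg ((mem_graph_inverse_iff hinj).mp (S.inverse.mem_graph x))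
    rwa [← inner_conj_symm, Complex.conj_re]
  · rw [mem_pcomp_graph, mem_graph_inverse_iff hG, ← hS.sq_eq, mem_pcomp_graph]
    simp only [mem_graph_inverse_iff hinj, and_comm]

end IsPositiveSqrt

theorem dense_range_of_isSymmetric_injective {C : H →L[ℂ] H} (hC : C.IsSymmetric)
    (hinj : Function.Injective C) : Dense (C.range : Set H) := by
  rw [Submodule.dense_iff_topologicalClosure_eq_top, Submodule.topologicalClosure_eq_top_iff,
    LinearMap.IsSymmetric.orthogonal_range hC]
  exact LinearMap.ker_eq_bot.mpr hinj

/-- With `R = (1 + T* T)⁻¹`, `C = R^{1/2}` and `D = (1 - R)^{1/2}`, the operator `D C⁻¹` is the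
positive square root of `T* T = (1 - R) R⁻¹`. -/
theorem exists_isPositiveSqrt {T : H →ₗ.[ℂ] K} (hd : Dense (T.domain : Set H))
    (hc : T.IsClosed) : ∃ S, IsPositiveSqrt (pcomp T.adjoint T) S := by
  obtain ⟨R, Q, h⟩ := exists_isResolventPair hd hc
  have hR := h.nonneg
  have hR' := h.one_sub_nonneg
  obtain ⟨C, hC⟩ : ∃ C, C = CFC.sqrt R := ⟨_, rfl⟩
  obtain ⟨D, hD⟩ : ∃ D, D = CFC.sqrt (1 - R) := ⟨_, rfl⟩
  have hC0 : 0 ≤ C := hC ▸ CFC.sqrt_nonneg R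
  have hD0 : 0 ≤ D := hD ▸ CFC.sqrt_nonneg (1 - R)
  have hCC : ∀ x, C (C x) = R x := fun x => by
    rw [hC, ← mul_apply_eq_comp, CFC.sqrt_mul_sqrt_self R hR]
  have hDD : ∀ x, D (D x) = x - R x := fun x => by
    rw [hD, ← mul_apply_eq_comp, CFC.sqrt_mul_sqrt_self (1 - R) hR']
    simp
  have hcomm : Commute C D := by
    rw [hC, hD, CFC.sqrt, CFC.sqrt]
    have h1 : Commute R (1 - R) := (Commute.one_right R).sub_right (Commute.refl R)
    exact ((h1.cfcₙ_nnreal _).symm.cfcₙ_nnreal _).symm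
  have hCD : ∀ x, C (D x) = D (C x) := fun x => congrArg (fun A : H →L[ℂ] H => A x) hcomm.eq
  have hCs : C.IsSymmetric := ((ContinuousLinearMap.nonneg_iff_isPositive C).mp hC0).isSymmetric
  have hDs : D.IsSymmetric := ((ContinuousLinearMap.nonneg_iff_isPositive D).mp hD0).isSymmetric
  have hCi : Function.Injective C := by
    intro x y hxy
    apply h.injective
    rw [← hCC, ← hCC, hxy]
  let Γ : Submodule ℂ (H × H) := (C.prod D).range
  let S : H →ₗ.[ℂ] H := Γ.toLinearPMap
  have hS : ∀ x y, (x, y) ∈ S.graph ↔ ∃ w, C w = x ∧ D w = y := by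
    intro x y
    have hΓ : S.graph = Γ := by
      refine Submodule.toLinearPMap_graph_eq _ ?_
      rintro _ ⟨w, rfl⟩ hw
      have : w = 0 := hCi (by simpa using hw)
      simp [this]
    rw [hΓ]
    constructor
    · rintro ⟨w, hw⟩
      exact ⟨w, congrArg Prod.fst hw, congrArg Prod.snd hw⟩
    · rintro ⟨w, rfl, rfl⟩
      exact ⟨w, rfl⟩
  have hSd : Dense (S.domain : Set H) := by
    refine (dense_range_of_isSymmetric_injective hCs hCi).mono ?_
    rintro _ ⟨w, rfl⟩
    exact LinearPMap.mem_domain_of_mem_graph ((hS _ _).mpr ⟨w, rfl, rfl⟩)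
  refine ⟨S, isSelfAdjoint_of_mem_graph_iff hSd fun y z => ?_, fun a => ?_, graph_ext fun x z => ?_⟩
  · -- membership of `(y, z)` in the graph, as in that of the adjoint, amounts to `D y = C z`
    rw [hS]
    constructor
    · rintro ⟨w, rfl, rfl⟩ f g hfg
      obtain ⟨v, rfl, rfl⟩ := (hS _ _).mp hfg
      have h1 : inner ℂ (D v) (C w) = inner ℂ v (D (C w)) := hDs v (C w)
      have h2 : inner ℂ (C v) (D w) = inner ℂ v (C (D w)) := hCs v (D w)
      rw [h1, h2, hCD]
    · intro hyz
      have h1 : D y = C z := by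
        refine ext_inner_left ℂ fun v => ?_
        have h1 : inner ℂ (D v) y = inner ℂ v (D y) := hDs v y
        have h2 : inner ℂ (C v) z = inner ℂ v (C z) := hCs v z
        rw [← h1, ← h2]
        exact hyz _ _ ((hS _ _).mpr ⟨v, rfl, rfl⟩)
      refine ⟨C y + D z, ?_, ?_⟩
      · rw [map_add, hCC, hCD, ← h1, hDD]; abel
      · rw [map_add, hDD, ← hCD, h1, hCC]; abel
  · obtain ⟨w, hw, hw'⟩ := (hS _ _).mp (S.mem_graph a)
    rw [← hw, ← hw']
    have h1 : inner ℂ (C (D w)) w = inner ℂ (D w) (C w) := hCs (D w) w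
    rw [← h1]
    exact ((ContinuousLinearMap.nonneg_iff_isPositive _).mp
      (hcomm.mul_nonneg hC0 hD0)).re_inner_nonneg_left w
  · rw [mem_pcomp_graph, h.mem_graph_pcomp_iff]
    constructor
    · rintro ⟨y, hxy, hyz⟩
      obtain ⟨v, rfl, rfl⟩ := (hS _ _).mp hxy
      obtain ⟨v', hv', rfl⟩ := (hS _ _).mp hyz
      -- `v = C w` and `v' = D w` for `w = C v + D v'`
      have h1 : C (C v + D v') = v := by
        rw [map_add, hCC, hCD, hv', hDD]; abel
      have h2 : D (C v + D v') = v' := by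
        rw [map_add, ← hCD, ← hv', hCC, hDD]; abel
      refine ⟨C v + D v', ?_, ?_⟩
      · rw [← hCC, h1]
      · rw [← hDD, h2]
    · rintro ⟨w, rfl, rfl⟩
      exact ⟨C (D w), (hS _ _).mpr ⟨C w, hCC w, (hCD w).symm⟩, (hS _ _).mpr ⟨D w, rfl, hDD w⟩⟩

end Sqrt

/-! ### Gram operators of a quasi Gelfand triple -/

section Gram

variable {E H0 : Type*} [NormedAddCommGroup E] [InnerProductSpace ℂ E]
  [NormedAddCommGroup H0] [InnerProductSpace ℂ H0]

theorem IsClosedEmbedding.dense_inverse_domain {ι : E →ₗ.[ℂ] H0} (h : IsClosedEmbedding ι) :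
    Dense (ι.inverse.domain : Set H0) := by
  rw [LinearPMap.inverse_domain]
  exact h.dense_range

theorem IsClosedEmbedding.isClosed_inverse {ι : E →ₗ.[ℂ] H0} (h : IsClosedEmbedding ι) :
    ι.inverse.IsClosed :=
  (LinearPMap.inverse_closed_iff (LinearMap.ker_eq_bot.mpr h.injective)).mpr h.isClosed

variable [CompleteSpace H0]

theorem IsClosedEmbedding.existsUnique_isPositiveSqrt [CompleteSpace E] {ι : E →ₗ.[ℂ] H0}
    (h : IsClosedEmbedding ι) : ∃! S, IsPositiveSqrt (gram ι) S := by
  obtain ⟨S, hS⟩ := exists_isPositiveSqrt h.dense_inverse_domain h.isClosed_inverse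
  exact ⟨S, hS, fun S' hS' => hS'.unique hS⟩

/-- The Gram operator maps `x = ι k` to the `y` with `⟪k', k⟫ = ⟪ι k', y⟫` for all `k'`. -/
theorem mem_graph_gram_iff {ι : E →ₗ.[ℂ] H0} (h : IsClosedEmbedding ι) {x y : H0} :
    (x, y) ∈ (gram ι).graph ↔ ∃ k, (k, x) ∈ ι.graph ∧
      ∀ k' x', (k', x') ∈ ι.graph → inner ℂ k' k = inner ℂ x' y := by
  rw [gram, mem_pcomp_graph]
  simp only [mem_graph_adjoint_iff h.dense_inverse_domain, mem_graph_inverse_iff h.injective]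
  exact exists_congr fun k => and_congr_right fun _ => forall_comm

theorem injective_gram {ι : E →ₗ.[ℂ] H0} (h : IsClosedEmbedding ι) :
    Function.Injective (gram ι).toFun := by
  rw [injective_toFun_iff]
  intro x hx
  obtain ⟨k, hk, hk'⟩ := (mem_graph_gram_iff h).mp hx
  have h1 : k = 0 := inner_self_eq_zero.mp ((hk' k x hk).trans (inner_zero_right x))
  exact ι.graph_fst_eq_zero_snd hk h1

/-- A closed densely defined operator equals its double adjoint; this is the inclusion `T** ⊆ T`,
written out in graphs. -/
theorem mem_graph_of_forall_adjoint [CompleteSpace E] {T : E →ₗ.[ℂ] H0}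
    (hd : Dense (T.domain : Set E)) (hc : T.IsClosed) {f : E} {y : H0}
    (h : ∀ x k, (x, k) ∈ T.adjoint.graph → inner ℂ k f = inner ℂ x y) : (f, y) ∈ T.graph := by
  let e := WithLp.prodContinuousLinearEquiv 2 ℂ E H0
  let Γ : Submodule ℂ (WithLp 2 (E × H0)) := T.graph.comap (e : WithLp 2 (E × H0) →ₗ[ℂ] E × H0)
  have hΓ : IsClosed (Γ : Set (WithLp 2 (E × H0))) := hc.preimage e.continuous
  have : CompleteSpace Γ := hΓ.completeSpace_coe
  -- `(f - u, y - v)` is the part of `(f, y)` orthogonal to the graph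
  obtain ⟨⟨u, v⟩, huv⟩ : ∃ w, e (Γ.starProjection (e.symm (f, y))) = w := ⟨_, rfl⟩
  have hmem : (u, v) ∈ T.graph := huv ▸ Γ.starProjection_apply_mem (e.symm (f, y))
  have hort : (y - v, -(f - u)) ∈ T.adjoint.graph := by
    rw [mem_graph_adjoint_iff hd]
    intro a b hab
    have h1 := Γ.sub_starProjection_mem_orthogonal (e.symm (f, y)) (e.symm (a, b)) hab
    rw [← e.symm_apply_apply (Γ.starProjection _), huv, WithLp.prod_inner_apply] at h1
    have h2 : inner ℂ a (f - u) + inner ℂ b (y - v) = 0 := h1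
    rw [inner_neg_right]
    linear_combination h2
  have h1 := h _ _ hort
  have h2 := (mem_graph_adjoint_iff hd).mp hort u v hmem
  rw [← inner_conj_symm, ← inner_conj_symm u, RingHom.injective (starRingEnd ℂ) |>.eq_iff] at h2
  have h3 : -inner ℂ (f - u) (f - u) = inner ℂ (y - v) (y - v) := by
    rw [← inner_neg_left, inner_sub_right _ f u, inner_sub_right _ y v, h1, h2]
  rw [inner_self_eq_norm_sq_to_K, inner_self_eq_norm_sq_to_K] at h3
  have h4 : -‖f - u‖ ^ 2 = ‖y - v‖ ^ 2 := by exact_mod_cast h3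
  have h5 : ‖f - u‖ = 0 := by nlinarith [sq_nonneg ‖y - v‖]
  have h6 : ‖y - v‖ = 0 := by nlinarith [sq_nonneg ‖f - u‖]
  rwa [sub_eq_zero.mp (norm_eq_zero.mp h5), sub_eq_zero.mp (norm_eq_zero.mp h6)]

variable {Hp Hm : Type*} [NormedAddCommGroup Hp] [InnerProductSpace ℂ Hp] [CompleteSpace Hp]
  [NormedAddCommGroup Hm] [InnerProductSpace ℂ Hm]

/-- The duality map of a complete dual pair of Hilbert spaces, composed with the Riesz
isomorphism. -/
theorem IsCompleteDualPair.exists_linearIsometry {p : Pairing Hm Hp} (h : IsCompleteDualPair p) :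
    ∃ U : Hm →ₗᵢ[ℂ] Hp, Function.Surjective U ∧ ∀ g f, p g f = inner ℂ f (U g) := by
  have hex : ∀ g, ∃ k, ∀ f, p g f = inner ℂ f k := by
    intro g
    let l : Hp →L[ℂ] ℂ := ((starL ℂ : ℂ ≃L⋆[ℂ] ℂ) : ℂ →L⋆[ℂ] ℂ).comp (p g)
    refine ⟨(InnerProductSpace.toDual ℂ Hp).symm l, fun f => ?_⟩
    rw [← inner_conj_symm, InnerProductSpace.toDual_symm_apply]
    exact (Complex.conj_conj _).symm
  choose U hU using hex
  let V : Hm →ₗ[ℂ] Hp :=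
    { toFun := U
      map_add' := fun a b => ext_inner_left ℂ fun f => by
        rw [inner_add_right, ← hU, ← hU, ← hU, map_add, add_apply]
      map_smul' := fun c a => ext_inner_left ℂ fun f => by
        rw [inner_smul_right, ← hU, ← hU, map_smul, smul_apply, smul_eq_mul,
          RingHom.id_apply] }
  have hnorm : ∀ g, ‖V g‖ = ‖g‖ := by
    intro g
    have hp : ‖p g‖ = ‖g‖ := by
      simpa using h.isometry_left.dist_eq g 0
    rw [← hp]
    refine le_antisymm ?_ (ContinuousLinearMap.opNorm_le_bound _ (norm_nonneg _) fun f => ?_)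
    · by_cases h0 : ‖V g‖ = 0
      · rw [h0]
        positivity
      · have h1 := (p g).le_opNorm (V g)
        rw [hU] at h1
        have h2 : ‖inner ℂ (V g) (V g)‖ = ‖V g‖ * ‖V g‖ := by
          rw [inner_self_eq_norm_sq_to_K]
          simp [sq]
        exact le_of_mul_le_mul_right (h2.symm.trans_le h1) (lt_of_le_of_ne' (norm_nonneg _) h0)
    · rw [hU, mul_comm]
      exact norm_inner_le_norm f (V g)
  refine ⟨⟨V, hnorm⟩, fun k => ?_, hU⟩
  obtain ⟨g, hg⟩ := h.bijective_left.2 ((innerSL ℂ).flip k)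
  refine ⟨g, ext_inner_left ℂ fun f => ?_⟩
  exact (hU g f).symm.trans (congrArg (fun l : Hp →L⋆[ℂ] ℂ => l f) hg)

/-- Identifying `Hm` with `Hp` by `U`, the triple says `ιm⁻¹ = U⁻¹ ιp*`, so that
`gram ιm = ιp** ιp* = ιp ιp*`, which is the inverse of `gram ιp = (ιp*)⁻¹ ιp⁻¹`. -/
theorem IsQuasiGelfandTriple.gram_minus_eq [CompleteSpace Hm] {p : Pairing Hm Hp}
    {ιp : Hp →ₗ.[ℂ] H0} {ιm : Hm →ₗ.[ℂ] H0} (h : IsQuasiGelfandTriple p ιp ιm) :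
    gram ιm = (gram ιp).inverse := by
  obtain ⟨U, hUs, hU⟩ := h.dualPair.exists_linearIsometry
  have hp := h.embedding_plus
  have hm := h.embedding_minus
  have hpair : ∀ {f y g x}, (f, y) ∈ ιp.graph → (g, x) ∈ ιm.graph →
      inner ℂ f (U g) = inner ℂ y x := by
    intro f y g x hf hg
    obtain ⟨a, rfl, rfl⟩ := (LinearPMap.mem_graph_iff ιp).mp hf
    obtain ⟨b, rfl, rfl⟩ := (LinearPMap.mem_graph_iff ιm).mp hg
    rw [← hU, h.pairing_eq]
  -- the Hilbert space adjoint of `ιp` is `U ιm⁻¹`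
  have hadj : ∀ {x k}, (x, k) ∈ ιp.adjoint.graph → ∃ g, U g = k ∧ (g, x) ∈ ιm.graph := by
    intro x k hxk
    rw [mem_graph_adjoint_iff hp.dense_domain] at hxk
    obtain ⟨g₀, rfl⟩ := hUs k
    have hx : x ∈ ran ιm := by
      rw [← h.dom_adjoint_eq]
      refine ⟨(x, g₀), ?_, rfl⟩
      rintro ⟨f, y⟩ hf
      rw [hilbertPairing_apply, hU]
      exact hxk f y hf
    obtain ⟨b, rfl⟩ := hx
    refine ⟨b, ?_, ιm.mem_graph b⟩
    refine hp.dense_domain.eq_of_inner_right ℂ fun f hf => ?_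
    have hf' := ιp.mem_graph ⟨f, hf⟩
    rw [hpair hf' (ιm.mem_graph b)]
    exact hxk _ _ hf'
  refine graph_ext fun x y => ?_
  rw [mem_graph_inverse_iff (injective_gram hp), mem_graph_gram_iff hm, mem_graph_gram_iff hp]
  constructor
  · rintro ⟨k, hk, hky⟩
    refine ⟨U k, mem_graph_of_forall_adjoint hp.dense_domain hp.isClosed ?_, ?_⟩
    · intro x' k' hx'
      obtain ⟨g, rfl, hg⟩ := hadj hx'
      rw [U.inner_map_map]
      exact hky _ _ hg
    · exact fun f' z hf' => hpair hf' hk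
  · rintro ⟨f, hf, hfx⟩
    obtain ⟨g, rfl, hg⟩ := hadj ((mem_graph_adjoint_iff hp.dense_domain).mpr
      fun f' z hz => (hfx f' z hz).symm)
    refine ⟨g, hg, fun k' x' hk' => ?_⟩
    rw [← U.inner_map_map, ← inner_conj_symm, hpair hf hk', inner_conj_symm]

end Gram

end QuasiGelfand

theorem mainTheorem11 {Hp H0 Hm : Type*}
    [NormedAddCommGroup Hp] [InnerProductSpace ℂ Hp] [CompleteSpace Hp]
    [NormedAddCommGroup H0] [InnerProductSpace ℂ H0] [CompleteSpace H0]
    [NormedAddCommGroup Hm] [InnerProductSpace ℂ Hm] [CompleteSpace Hm]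
    (p : QuasiGelfand.Pairing Hm Hp) (ιp : Hp →ₗ.[ℂ] H0) (ιm : Hm →ₗ.[ℂ] H0)
    (h : QuasiGelfand.IsQuasiGelfandTriple p ιp ιm) :
    (Function.Injective (QuasiGelfand.gram ιp).toFun ∧
      QuasiGelfand.gram ιm = (QuasiGelfand.gram ιp).inverse) ∧
    (∃! S, QuasiGelfand.IsPositiveSqrt (QuasiGelfand.gram ιp) S) ∧
    (∃! S, QuasiGelfand.IsPositiveSqrt (QuasiGelfand.gram ιm) S) ∧
    ∀ Sp Sm : H0 →ₗ.[ℂ] H0,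
      QuasiGelfand.IsPositiveSqrt (QuasiGelfand.gram ιp) Sp →
      QuasiGelfand.IsPositiveSqrt (QuasiGelfand.gram ιm) Sm →
      QuasiGelfand.ran ιm = Sm.domain ∧
      Sm.domain = Sp.inverse.domain ∧
      Sp.inverse.domain = QuasiGelfand.ran Sp := by
  have hp := h.embedding_plus
  have hm := h.embedding_minus
  have hinj := QuasiGelfand.injective_gram hp
  refine ⟨⟨hinj, h.gram_minus_eq⟩, hp.existsUnique_isPositiveSqrt,
    hm.existsUnique_isPositiveSqrt, fun Sp Sm hSp hSm => ⟨?_, ?_, ?_⟩⟩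
  · rw [← hSm.domain_eq hm.dense_inverse_domain hm.isClosed_inverse, LinearPMap.inverse_domain]
    rfl
  · rw [hSm.unique (h.gram_minus_eq ▸ hSp.inverse hinj)]
  · exact LinearPMap.inverse_domain
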